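/- Let $X$ be a non-negative real random variable on a probability space $(\Omega,\mathcal F,\mathbb P)$, let $X_1,X_2,\dots$ be independent random variables on it with the same distribution as $X$, and set $S_n=X_1+\cdots+X_n$. With the convention $\log 0=-\infty$, put $$\bar\alpha=-\limsup_{t\to\infty}\frac1t\log\mathbb P(\log X>t),\qquad \underline\alpha=-\liminf_{t\to\infty}\frac1t\log\mathbb P(\log X>t),$$ which are elements of $[0,\infty]$. All limits below are taken in $[-\infty,\infty]$, and $(\pm\infty-p)/p=\pm\infty$ for $p\in(0,\infty)$. (i) Suppose that $0<p<1$ and $\lim_{n\to\infty} n\,\mathbb P(X>n^{1/p})=0$. Then, for every $s>0$, $$\limsup_{n\to\infty}\frac{1}{\log n}\log\mathbb P\left(S_n>s\,n^{1/p}\right)=-\frac{\bar\alpha-p}{p},\qquad \liminf_{n\to\infty}\frac{1}{\log n}\log\mathbb P\left(S_n>s\,n^{1/p}\right)=-\frac{\underline\alpha-p}{p}.$$ Moreover, for every $s>0$ and every $\hat\alpha\in[-\infty,\infty]$, $$\lim_{n\to\infty}\frac{1}{\log n}\log\mathbb P\left(S_n>s\,n^{1/p}\right)=-\frac{\hat\alpha-p}{p}\quad\text{if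 and only if}\quad\bar\alpha=\underline\alpha=\hat\alpha.$$ (ii) Suppose that $1\le p<2$, that $X$ is integrable with $\mathbb E X=\mu\in(0,\infty)$, and that $\lim_{n\to\infty} n\,\mathbb P(X>n^{1/p})=0$. Then, for every $s>0$, $$\limsup_{n\to\infty}\frac{1}{\log n}\log\mathbb P\left(S_n>n\mu+s\,n^{1/p}\right)=-\frac{\bar\alpha-p}{p},\qquad \liminf_{n\to\infty}\frac{1}{\log n}\log\mathbb P\left(S_n>n\mu+s\,n^{1/p}\right)=-\frac{\underline\alpha-p}{p}.$$ Moreover, for every $s>0$ and every $\hat\alpha\in[-\infty,\infty]$, $$\lim_{n\to\infty}\frac{1}{\log n}\log\mathbb P\left(S_n>n\mu+s\,n^{1/p}\right)=-\frac{\hat\alpha-p}{p}\quad\text{if and only if}\quad\bar\alpha=\underline\alpha=\hat\alpha.$$ -/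

import Mathlib

open Filter Topology MeasureTheory ProbabilityTheory
open scoped ENNReal

/-- The upper tail exponent `-limsup_{t → ∞} (1/t) log P(log X > t)`, in the extended reals.
`ENNReal.log` is the extended logarithm, with `log 0 = -∞`.  Only large `t` matter, and for
`t > 0` and `X ≥ 0` the event `t < Real.log X` is `X > exp t`, also where `X = 0`. -/
noncomputable def upperTailExponent {Ω : Type*} [MeasurableSpace Ω] (P : Measure Ω)
    (X : Ω → ℝ) : EReal :=
  -limsup (fun t : ℝ => ((1 / t : ℝ) : EReal) * ENNReal.log (P {ω | t < Real.log (X ω)})) atTop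

/-- The lower tail exponent `-liminf_{t → ∞} (1/t) log P(log X > t)`, in the extended reals. -/
noncomputable def lowerTailExponent {Ω : Type*} [MeasurableSpace Ω] (P : Measure Ω)
    (X : Ω → ℝ) : EReal :=
  -liminf (fun t : ℝ => ((1 / t : ℝ) : EReal) * ENNReal.log (P {ω | t < Real.log (X ω)})) atTop

/-- The normalized logarithmic probability `(1 / log n) log P(A)`, in the extended reals
(with `log 0 = -∞`). -/
noncomputable def logRate {Ω : Type*} [MeasurableSpace Ω] (P : Measure Ω)
    (n : ℕ) (A : Set Ω) : EReal :=
  ((1 / Real.log n : ℝ) : EReal) * ENNReal.log (P A)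

/-- The partial sum of the first `n` terms of the sequence. -/
noncomputable def partialSum {Ω : Type*} (Xs : ℕ → Ω → ℝ) (n : ℕ) (ω : Ω) : ℝ :=
  ∑ i ∈ Finset.range n, Xs i ω

/-! This is the principle of one big jump. Put `L = log n`, `g t = P(X > exp t)`, and let `m` be the
centering, `0` in (i) and `μ` in (ii). The probability `a n` in question is comparable, on the
logarithmic scale, to `n * g (L / p)`, so a tail exponent `α` becomes the rate `1 - α / p`.

Upper bound (`measure_lt_sum_le`): either some summand exceeds `exp t`, at cost `n * g t`, or the
truncated sum is large. By Chernoff the latter costs `exp (D - s * exp (c * (L / p - t)))`, which at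
`t = ρ * L / p` with `ρ < 1` is below every power of `n`; then `ρ` is taken close to `1`.

Lower bound (`le_measure_lt_sum`): one summand exceeds `K * n ^ (1 / p)` while the others stay near
their centering, whence `a n ≥ n * g (L / p + log K) / 4`.

The tail hypothesis gives `P(X > t) ≤ C * t ^ (-p)`, hence the exponential moments, and makes two
big jumps unlikely. -/

lemma inv_mul_log_le_iff {t : ℝ} (ht : 0 < t) (g : ℝ≥0∞) (r : ℝ) :
    ((1 / t : ℝ) : EReal) * ENNReal.log g ≤ (r : EReal) ↔
      g ≤ ENNReal.ofReal (Real.exp (r * t)) := by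
  have h1 : ((1 / t : ℝ) : EReal) * ENNReal.log g = ENNReal.log g / (t : EReal) := by
    rw [one_div, EReal.coe_inv, EReal.div_eq_inv_mul]
  rw [h1, EReal.div_le_iff_le_mul (by exact_mod_cast ht) (EReal.coe_ne_top t),
    ← ENNReal.log_le_log_iff (x := g), ENNReal.log_ofReal_of_pos (Real.exp_pos _), Real.log_exp]
  push_cast
  rw [mul_comm]

lemma le_inv_mul_log_iff {t : ℝ} (ht : 0 < t) (g : ℝ≥0∞) (r : ℝ) :
    (r : EReal) ≤ ((1 / t : ℝ) : EReal) * ENNReal.log g ↔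
      ENNReal.ofReal (Real.exp (r * t)) ≤ g := by
  have h1 : ((1 / t : ℝ) : EReal) * ENNReal.log g = ENNReal.log g / (t : EReal) := by
    rw [one_div, EReal.coe_inv, EReal.div_eq_inv_mul]
  rw [h1, EReal.le_div_iff_mul_le (by exact_mod_cast ht) (EReal.coe_ne_top t),
    ← ENNReal.log_le_log_iff (y := g), ENNReal.log_ofReal_of_pos (Real.exp_pos _), Real.log_exp]
  push_cast
  rfl

/-- Solving `z = 1 - α / p` gives `α = p * (1 - z)`. Testing rates against real `z` only reduces
everything to real exponential inequalities, infinite exponents included. -/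
lemma neg_sub_div_lt_coe_iff {p : ℝ} (hp : 0 < p) (A : EReal) (z : ℝ) :
    -((A - (p : EReal)) / (p : EReal)) < (z : EReal) ↔ ((p * (1 - z) : ℝ) : EReal) < A := by
  induction A with
  | bot => simp [EReal.bot_div_of_pos_ne_top (by exact_mod_cast hp) (EReal.coe_ne_top p)]
  | top => simp [EReal.top_div_of_pos_ne_top (by exact_mod_cast hp) (EReal.coe_ne_top p),
      -EReal.coe_mul]
  | coe A =>
    have : -(((A : EReal) - (p : EReal)) / (p : EReal)) = ((-((A - p) / p) : ℝ) : EReal) := by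
      push_cast; rfl
    rw [this, EReal.coe_lt_coe_iff, EReal.coe_lt_coe_iff, neg_lt, lt_div_iff₀ hp]
    constructor <;> intro h <;> linarith

lemma coe_lt_neg_sub_div_iff {p : ℝ} (hp : 0 < p) (A : EReal) (z : ℝ) :
    (z : EReal) < -((A - (p : EReal)) / (p : EReal)) ↔ A < ((p * (1 - z) : ℝ) : EReal) := by
  induction A with
  | bot => simp [EReal.bot_div_of_pos_ne_top (by exact_mod_cast hp) (EReal.coe_ne_top p),
      -EReal.coe_mul]
  | top => simp [EReal.top_div_of_pos_ne_top (by exact_mod_cast hp) (EReal.coe_ne_top p)]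
  | coe A =>
    have : -(((A : EReal) - (p : EReal)) / (p : EReal)) = ((-((A - p) / p) : ℝ) : EReal) := by
      push_cast; rfl
    rw [this, EReal.coe_lt_coe_iff, EReal.coe_lt_coe_iff, lt_neg, div_lt_iff₀ hp]
    constructor <;> intro h <;> linarith

lemma neg_sub_div_injective {p : ℝ} (hp : 0 < p) :
    Function.Injective fun A : EReal => -((A - (p : EReal)) / (p : EReal)) := by
  have key : ∀ A B : EReal, -((A - (p : EReal)) / (p : EReal)) = -((B - (p : EReal)) / (p : EReal)) →
      A ≤ B := by
    intro A B h
    refine EReal.le_of_forall_lt_iff_le.1 fun w hw => ?_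
    have e : p * (1 - (1 - w / p)) = w := by field_simp; ring
    have := coe_lt_neg_sub_div_iff hp B (1 - w / p)
    rw [e, ← h, coe_lt_neg_sub_div_iff hp, e] at this
    exact (this.2 hw).le
  intro A B h
  exact le_antisymm (key A B h) (key B A h.symm)

/-! ### Comparison of tails at real `t` with tails along `log n`. -/

lemma tendsto_log_natCast_atTop : Tendsto (fun n : ℕ => Real.log n) atTop atTop :=
  Real.tendsto_log_atTop.comp tendsto_natCast_atTop_atTop

/-- A double exponential decay eventually beats every exponential one. -/
lemma eventually_sub_mul_exp_le {s γ : ℝ} (hs : 0 < s) (hγ : 0 < γ) (C b : ℝ) :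
    ∀ᶠ L : ℝ in atTop, C - s * Real.exp (γ * L) ≤ b * L := by
  have h1 : Tendsto (fun L : ℝ => Real.exp (γ * L) / (γ * L) ^ 1) atTop atTop :=
    (Real.tendsto_exp_div_pow_atTop 1).comp (tendsto_id.const_mul_atTop hγ)
  filter_upwards [h1.eventually_ge_atTop ((|b| + 1) / (s * γ)), eventually_gt_atTop 0,
    eventually_ge_atTop C] with L h2 hL hC
  rw [pow_one, le_div_iff₀ (by positivity)] at h2
  have h3 : (|b| + 1) * L ≤ s * Real.exp (γ * L) := by
    calc (|b| + 1) * L = s * ((|b| + 1) / (s * γ) * (γ * L)) := by field_simp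
      _ ≤ _ := by gcongr
  have h4 : -|b| * L ≤ b * L := by gcongr; exact neg_abs_le b
  nlinarith

/-- At `t = ρ * log n / p` the jump term is at most `n ^ (1 - β * ρ / p)` and the Chernoff term
decays faster than any power; each is eventually below half the target. Keeping the tail bound as a
premise inside `∀ᶠ` lets the lemma serve both eventual and frequent tail bounds. -/
lemma eventually_le_exp_of_tail_le {g : ℝ → ℝ≥0∞} {a : ℕ → ℝ≥0∞} {p C c s : ℝ} (hp : 0 < p)
    (hc : 0 < c) (hs : 0 < s)
    (hU : ∀ n : ℕ, 1 ≤ n → ∀ t : ℝ, 0 ≤ t → t ≤ Real.log n / p →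
      a n ≤ n * g t + ENNReal.ofReal (Real.exp (C - s * Real.exp (c * (Real.log n / p - t)))))
    {α ρ β : ℝ} (hρ0 : 0 < ρ) (hρ1 : ρ < 1) (hβ : α < β * ρ) :
    ∀ᶠ n : ℕ in atTop,
      g (ρ / p * Real.log n) ≤ ENNReal.ofReal (Real.exp (-β * (ρ / p * Real.log n))) →
        a n ≤ ENNReal.ofReal (Real.exp ((1 - α / p) * Real.log n)) := by
  have hγ : 0 < c * (1 - ρ) / p := by have := sub_pos.2 hρ1; positivity
  have hδ : 0 < (β * ρ - α) / p := by have := sub_pos.2 hβ; positivity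
  have hE := eventually_sub_mul_exp_le hs hγ (C + Real.log 2) (1 - α / p)
  have hF : ∀ᶠ L : ℝ in atTop, Real.log 2 ≤ (β * ρ - α) / p * L :=
    (tendsto_id.const_mul_atTop hδ).eventually_ge_atTop _
  filter_upwards [tendsto_log_natCast_atTop.eventually hE, tendsto_log_natCast_atTop.eventually hF,
    eventually_ge_atTop 1] with n h1 h2 hn hg
  have hL : 0 ≤ Real.log n := Real.log_natCast_nonneg n
  have hn0 : (0 : ℝ) < n := by exact_mod_cast hn
  have hu := hU n hn (ρ / p * Real.log n) (by positivity) (by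
    rw [div_mul_eq_mul_div]; gcongr; nlinarith)
  refine hu.trans ?_
  have e1 : (n : ℝ≥0∞) = ENNReal.ofReal (Real.exp (Real.log n)) := by
    rw [Real.exp_log hn0, ENNReal.ofReal_natCast]
  calc _ ≤ ENNReal.ofReal (Real.exp (Real.log n)) *
          ENNReal.ofReal (Real.exp (-β * (ρ / p * Real.log n))) +
          ENNReal.ofReal (Real.exp ((1 - α / p) * Real.log n - Real.log 2)) := by
        rw [← e1]
        refine add_le_add (mul_le_mul_right hg _) (ENNReal.ofReal_le_ofReal (Real.exp_le_exp.2 ?_))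
        have : c * (Real.log n / p - ρ / p * Real.log n) = c * (1 - ρ) / p * Real.log n := by ring
        rw [this]; linarith
    _ ≤ ENNReal.ofReal (Real.exp ((1 - α / p) * Real.log n - Real.log 2)) +
          ENNReal.ofReal (Real.exp ((1 - α / p) * Real.log n - Real.log 2)) := by
        rw [← ENNReal.ofReal_mul (Real.exp_pos _).le, ← Real.exp_add]
        gcongr
        have : (β * ρ - α) / p * Real.log n = β * (ρ / p * Real.log n) - α / p * Real.log n := by
          ring
        linarith
    _ = _ := by
        rw [← ENNReal.ofReal_add (by positivity) (by positivity), Real.exp_sub,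
          Real.exp_log (by norm_num)]
        congr 1; ring

/-- The gap `β < α` yields a positive power of `n`, which absorbs the constants `k` and `κ`. -/
lemma eventually_exp_le_of_le_tail {g : ℝ → ℝ≥0∞} {a : ℕ → ℝ≥0∞} {p k κ : ℝ} (hp : 0 < p)
    (hk : 0 < k)
    (hL : ∀ᶠ n : ℕ in atTop, ENNReal.ofReal k * n * g (1 / p * Real.log n + κ) ≤ a n)
    {α β : ℝ} (hβ : β < α) :
    ∀ᶠ n : ℕ in atTop,
      ENNReal.ofReal (Real.exp (-β * (1 / p * Real.log n + κ))) ≤ g (1 / p * Real.log n + κ) →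
        ENNReal.ofReal (Real.exp ((1 - α / p) * Real.log n)) ≤ a n := by
  have hδ : 0 < (α - β) / p := by have := sub_pos.2 hβ; positivity
  have hF : ∀ᶠ L : ℝ in atTop, β * κ - Real.log k ≤ (α - β) / p * L :=
    (tendsto_id.const_mul_atTop hδ).eventually_ge_atTop _
  filter_upwards [hL, tendsto_log_natCast_atTop.eventually hF, eventually_ge_atTop 1]
    with n h1 h2 hn hg
  have hn0 : (0 : ℝ) < n := by exact_mod_cast hn
  have e1 : (n : ℝ≥0∞) = ENNReal.ofReal (Real.exp (Real.log n)) := by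
    rw [Real.exp_log hn0, ENNReal.ofReal_natCast]
  have e2 : ENNReal.ofReal k = ENNReal.ofReal (Real.exp (Real.log k)) := by
    rw [Real.exp_log hk]
  refine le_trans ?_ ((mul_le_mul_right hg _).trans h1)
  rw [e1, e2, ← ENNReal.ofReal_mul (Real.exp_pos _).le, ← ENNReal.ofReal_mul (by positivity),
    ← Real.exp_add, ← Real.exp_add]
  gcongr
  have : (α - β) / p * Real.log n = α / p * Real.log n - β * (1 / p * Real.log n) := by ring
  linarith

lemma tendsto_affine_log_atTop {b : ℝ} (hb : 0 < b) (d : ℝ) :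
    Tendsto (fun n : ℕ => b * Real.log n + d) atTop atTop :=
  tendsto_atTop_add_const_right _ _ (tendsto_log_natCast_atTop.const_mul_atTop hb)

/-- Every large real number lies within distance `1` above some `b * log n + d`. -/
lemma exists_affine_log_le {b : ℝ} (hb : 0 < b) (d : ℝ) (N : ℕ) :
    ∀ᶠ t : ℝ in atTop, ∃ n ≥ N, b * Real.log n + d ≤ t ∧ t ≤ b * Real.log n + d + b := by
  have h1 : Tendsto (fun t : ℝ => (t - d) / b) atTop atTop :=
    (tendsto_atTop_add_const_right _ (-d) tendsto_id).atTop_div_const hb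
  have h2 : Tendsto (fun t : ℝ => ⌊Real.exp ((t - d) / b)⌋₊) atTop atTop :=
    tendsto_nat_floor_atTop.comp (Real.tendsto_exp_atTop.comp h1)
  filter_upwards [h2.eventually_ge_atTop (N + 1)] with t ht
  refine ⟨⌊Real.exp ((t - d) / b)⌋₊, by omega, ?_, ?_⟩
  all_goals set m := ⌊Real.exp ((t - d) / b)⌋₊ with hm
  all_goals have hm1 : (1 : ℝ) ≤ m := by exact_mod_cast (by omega : 1 ≤ m)
  · have : Real.log m ≤ (t - d) / b := by
      rw [Real.log_le_iff_le_exp (by linarith)]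
      exact Nat.floor_le (Real.exp_pos _).le
    rw [le_div_iff₀ hb] at this; linarith
  -- As `m ≥ 1`, the floor loses at most a factor `e`: `m + 1 ≤ 2 * m ≤ e * m`.
  · have h3 : Real.exp ((t - d) / b) ≤ Real.exp (Real.log m + 1) := by
      rw [Real.exp_add, Real.exp_log (by linarith)]
      have := Nat.lt_floor_add_one (Real.exp ((t - d) / b))
      have := Real.add_one_le_exp (1 : ℝ)
      nlinarith
    have := Real.exp_le_exp.1 h3
    rw [div_le_iff₀ hb] at this; linarith

lemma exists_le_affine_log {b : ℝ} (hb : 0 < b) (d : ℝ) (N : ℕ) :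
    ∀ᶠ t : ℝ in atTop, ∃ n ≥ N, t ≤ b * Real.log n + d ∧ b * Real.log n + d ≤ t + b := by
  filter_upwards [(tendsto_atTop_add_const_right _ b tendsto_id).eventually
    (exists_affine_log_le hb d N)] with t ht
  obtain ⟨n, hn, h1, h2⟩ := ht
  exact ⟨n, hn, by simp only [id] at h2; linarith, h1⟩

/-- Frequent bounds do not restrict to a sequence by themselves. Monotonicity moves the bound from
`t` to a grid point within distance `b` below, and `(β - α) * t ≥ β * b` pays for the move. The next
lemma moves upward instead. -/
lemma frequently_le_comp_affine_log {g : ℝ → ℝ≥0∞} (hg : Antitone g) {b : ℝ} (hb : 0 < b) (d : ℝ)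
    {α β : ℝ} (hα : 0 ≤ α) (hαβ : α < β)
    (h : ∃ᶠ t : ℝ in atTop, ENNReal.ofReal (Real.exp (-α * t)) ≤ g t) :
    ∃ᶠ n : ℕ in atTop, ENNReal.ofReal (Real.exp (-β * (b * Real.log n + d))) ≤
      g (b * Real.log n + d) := by
  rw [frequently_atTop]
  intro N
  obtain ⟨t, ht, ⟨n, hn, h1, h2⟩, h3⟩ := (h.and_eventually ((exists_affine_log_le hb d N).and
    ((tendsto_id.const_mul_atTop (sub_pos.2 hαβ)).eventually_ge_atTop (β * b)))).exists
  refine ⟨n, hn, le_trans ?_ (ht.trans (hg h1))⟩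
  refine ENNReal.ofReal_le_ofReal (Real.exp_le_exp.2 ?_)
  simp only [id] at h3
  nlinarith

lemma frequently_comp_affine_log_le {g : ℝ → ℝ≥0∞} (hg : Antitone g) {b : ℝ} (hb : 0 < b) (d : ℝ)
    {α β : ℝ} (hα : 0 ≤ α) (hαβ : α < β)
    (h : ∃ᶠ t : ℝ in atTop, g t ≤ ENNReal.ofReal (Real.exp (-β * t))) :
    ∃ᶠ n : ℕ in atTop, g (b * Real.log n + d) ≤
      ENNReal.ofReal (Real.exp (-α * (b * Real.log n + d))) := by
  rw [frequently_atTop]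
  intro N
  obtain ⟨t, ht, ⟨n, hn, h1, h2⟩, h3⟩ := (h.and_eventually ((exists_le_affine_log hb d N).and
    ((tendsto_id.const_mul_atTop (sub_pos.2 hαβ)).eventually_ge_atTop (α * b)))).exists
  refine ⟨n, hn, ((hg h1).trans ht).trans ?_⟩
  refine ENNReal.ofReal_le_ofReal (Real.exp_le_exp.2 ?_)
  simp only [id] at h3
  nlinarith

/-! ### From two-sided bounds on `a n` to its logarithmic rates. -/

section Rates

variable {g : ℝ → ℝ≥0∞} {a : ℕ → ℝ≥0∞} {p C c s k κ : ℝ}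

lemma eventually_log_natCast_pos : ∀ᶠ n : ℕ in atTop, 0 < Real.log n :=
  tendsto_log_natCast_atTop.eventually_gt_atTop 0

lemma limsup_rate_le (hp : 0 < p) (hc : 0 < c) (hs : 0 < s) (ha : ∀ n, a n ≤ 1)
    (hU : ∀ n : ℕ, 1 ≤ n → ∀ t : ℝ, 0 ≤ t → t ≤ Real.log n / p →
      a n ≤ n * g t + ENNReal.ofReal (Real.exp (C - s * Real.exp (c * (Real.log n / p - t))))) :
    limsup (fun n : ℕ => ((1 / Real.log n : ℝ) : EReal) * ENNReal.log (a n)) atTop ≤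
      -((-limsup (fun t : ℝ => ((1 / t : ℝ) : EReal) * ENNReal.log (g t)) atTop - (p : EReal))
        / (p : EReal)) := by
  refine EReal.le_of_forall_lt_iff_le.1 fun z hz => ?_
  rw [neg_sub_div_lt_coe_iff hp] at hz
  suffices ∀ᶠ n : ℕ in atTop, a n ≤ ENNReal.ofReal (Real.exp (z * Real.log n)) by
    refine limsup_le_of_le (by isBoundedDefault) ?_
    filter_upwards [this, eventually_log_natCast_pos] with n h1 h2
    exact (inv_mul_log_le_iff h2 _ _).2 h1
  -- Nonnegative `z` is trivial because `a n ≤ 1`; negative `z` makes `α`, hence `β`, positive.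
  rcases le_or_gt 0 z with h0 | h0
  · filter_upwards [eventually_log_natCast_pos] with n h2
    refine (ha n).trans (ENNReal.one_le_ofReal.2 (Real.one_le_exp (by positivity)))
  obtain ⟨β, hβ, hβ'⟩ := EReal.lt_iff_exists_real_btwn.1 hz
  rw [EReal.coe_lt_coe_iff] at hβ
  set α := p * (1 - z) with hα
  have hα0 : 0 < α := by have : 0 < 1 - z := by linarith
                         positivity
  have hβ0 : 0 < β := hα0.trans hβ
  have hev := eventually_lt_of_limsup_lt (EReal.lt_neg_comm.1 hβ')
  -- This `ρ` is below `1`, and `β * ρ` is the midpoint of `α` and `β`, hence above `α`.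
  have hρ : 0 < (α + β) / (2 * β) := by positivity
  filter_upwards [eventually_le_exp_of_tail_le (α := α) (β := β) (ρ := (α + β) / (2 * β)) hp hc hs
    hU hρ (by rw [div_lt_one (by positivity)]; linarith)
    (by rw [show β * ((α + β) / (2 * β)) = (α + β) / 2 by field_simp]; linarith),
    (tendsto_affine_log_atTop (b := (α + β) / (2 * β) / p) (by positivity) 0).eventually
      (hev.and (eventually_gt_atTop 0))] with n h1 h2
  rw [add_zero] at h2
  have e : 1 - α / p = z := by rw [hα]; field_simp; ring
  rw [e] at h1
  exact h1 ((inv_mul_log_le_iff h2.2 _ _).1 (by push_cast; exact h2.1.le))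

lemma liminf_rate_le (hg : Antitone g) (hp : 0 < p) (hc : 0 < c) (hs : 0 < s) (ha : ∀ n, a n ≤ 1)
    (hU : ∀ n : ℕ, 1 ≤ n → ∀ t : ℝ, 0 ≤ t → t ≤ Real.log n / p →
      a n ≤ n * g t + ENNReal.ofReal (Real.exp (C - s * Real.exp (c * (Real.log n / p - t))))) :
    liminf (fun n : ℕ => ((1 / Real.log n : ℝ) : EReal) * ENNReal.log (a n)) atTop ≤
      -((-liminf (fun t : ℝ => ((1 / t : ℝ) : EReal) * ENNReal.log (g t)) atTop - (p : EReal))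
        / (p : EReal)) := by
  refine EReal.le_of_forall_lt_iff_le.1 fun z hz => ?_
  rw [neg_sub_div_lt_coe_iff hp] at hz
  suffices ∃ᶠ n : ℕ in atTop, a n ≤ ENNReal.ofReal (Real.exp (z * Real.log n)) by
    refine liminf_le_of_frequently_le ?_ (by isBoundedDefault)
    refine (this.and_eventually eventually_log_natCast_pos).mono fun n hn => ?_
    exact (inv_mul_log_le_iff hn.2 _ _).2 hn.1
  rcases le_or_gt 0 z with h0 | h0
  · refine Eventually.frequently ?_
    filter_upwards [eventually_log_natCast_pos] with n h2
    refine (ha n).trans (ENNReal.one_le_ofReal.2 (Real.one_le_exp (by positivity)))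
  obtain ⟨β', hβ1, hβ'⟩ := EReal.lt_iff_exists_real_btwn.1 hz
  rw [EReal.coe_lt_coe_iff] at hβ1
  -- Two gaps are needed: `β < β'` pays for passing to the grid, `α < β` for taking `ρ < 1`.
  obtain ⟨β, hβ, hββ'⟩ := exists_between hβ1
  set α := p * (1 - z) with hα
  have hα0 : 0 < α := by have : 0 < 1 - z := by linarith
                         positivity
  have hβ0 : 0 < β := hα0.trans hβ
  have hfr := frequently_lt_of_liminf_lt (by isBoundedDefault) (EReal.lt_neg_comm.1 hβ')
  have hfr2 : ∃ᶠ t : ℝ in atTop, g t ≤ ENNReal.ofReal (Real.exp (-β' * t)) :=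
    (hfr.and_eventually (eventually_gt_atTop 0)).mono fun t ht =>
      (inv_mul_log_le_iff ht.2 _ _).1 (by push_cast; exact ht.1.le)
  have hρ : 0 < (α + β) / (2 * β) := by positivity
  have e : 1 - α / p = z := by rw [hα]; field_simp; ring
  have key := eventually_le_exp_of_tail_le (α := α) (β := β) (ρ := (α + β) / (2 * β)) hp hc hs
    hU hρ (by rw [div_lt_one (by positivity)]; linarith)
    (by rw [show β * ((α + β) / (2 * β)) = (α + β) / 2 by field_simp]; linarith)
  refine ((frequently_comp_affine_log_le hg (b := (α + β) / (2 * β) / p) (by positivity) 0 hβ0.le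
    hββ' hfr2).and_eventually key).mono fun n hn => ?_
  rw [add_zero, e] at hn
  exact hn.2 hn.1

lemma le_limsup_rate (hg : Antitone g) (hg1 : ∀ t, g t ≤ 1) (hp : 0 < p) (hk : 0 < k)
    (hL : ∀ᶠ n : ℕ in atTop, ENNReal.ofReal k * n * g (1 / p * Real.log n + κ) ≤ a n) :
    -((-limsup (fun t : ℝ => ((1 / t : ℝ) : EReal) * ENNReal.log (g t)) atTop - (p : EReal))
        / (p : EReal)) ≤
      limsup (fun n : ℕ => ((1 / Real.log n : ℝ) : EReal) * ENNReal.log (a n)) atTop := by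
  refine EReal.ge_of_forall_gt_iff_ge.1 fun z hz => ?_
  rw [coe_lt_neg_sub_div_iff hp] at hz
  suffices ∃ᶠ n : ℕ in atTop, ENNReal.ofReal (Real.exp (z * Real.log n)) ≤ a n by
    refine le_limsup_of_frequently_le ?_ (by isBoundedDefault)
    refine (this.and_eventually eventually_log_natCast_pos).mono fun n hn => ?_
    exact (le_inv_mul_log_iff hn.2 _ _).2 hn.1
  obtain ⟨β', hβ', hβ1⟩ := EReal.lt_iff_exists_real_btwn.1 hz
  rw [EReal.coe_lt_coe_iff] at hβ1
  obtain ⟨β, hββ', hβ⟩ := exists_between hβ1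
  set α := p * (1 - z) with hα
  have hnn : limsup (fun t : ℝ => ((1 / t : ℝ) : EReal) * ENNReal.log (g t)) atTop ≤ 0 := by
    refine limsup_le_of_le (by isBoundedDefault) ?_
    filter_upwards [eventually_gt_atTop 0] with t ht
    exact (inv_mul_log_le_iff ht (g t) 0).2 (by simpa using hg1 t)
  have hβ0 : 0 ≤ β' := by
    have h1 : (0 : EReal) ≤ β' := (EReal.le_neg_of_le_neg (by simpa using hnn)).trans hβ'.le
    exact_mod_cast h1
  have hfr := frequently_lt_of_lt_limsup (by isBoundedDefault) (EReal.neg_lt_comm.1 hβ')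
  have hfr2 : ∃ᶠ t : ℝ in atTop, ENNReal.ofReal (Real.exp (-β' * t)) ≤ g t :=
    (hfr.and_eventually (eventually_gt_atTop 0)).mono fun t ht =>
      (le_inv_mul_log_iff ht.2 _ _).1 (by push_cast; exact ht.1.le)
  have e : 1 - α / p = z := by rw [hα]; field_simp; ring
  refine ((frequently_le_comp_affine_log hg (b := 1 / p) (by positivity) κ hβ0
    hββ' hfr2).and_eventually (eventually_exp_le_of_le_tail hp hk hL hβ)).mono fun n hn => ?_
  rw [e] at hn
  exact hn.2 hn.1

lemma le_liminf_rate (hp : 0 < p) (hk : 0 < k)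
    (hL : ∀ᶠ n : ℕ in atTop, ENNReal.ofReal k * n * g (1 / p * Real.log n + κ) ≤ a n) :
    -((-liminf (fun t : ℝ => ((1 / t : ℝ) : EReal) * ENNReal.log (g t)) atTop - (p : EReal))
        / (p : EReal)) ≤
      liminf (fun n : ℕ => ((1 / Real.log n : ℝ) : EReal) * ENNReal.log (a n)) atTop := by
  refine EReal.ge_of_forall_gt_iff_ge.1 fun z hz => ?_
  rw [coe_lt_neg_sub_div_iff hp] at hz
  obtain ⟨β, hβ', hβ⟩ := EReal.lt_iff_exists_real_btwn.1 hz
  rw [EReal.coe_lt_coe_iff] at hβ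
  have hev := eventually_lt_of_lt_liminf (EReal.neg_lt_comm.1 hβ')
  have e : 1 - p * (1 - z) / p = z := by field_simp; ring
  refine le_liminf_of_le (by isBoundedDefault) ?_
  filter_upwards [eventually_log_natCast_pos, eventually_exp_le_of_le_tail hp hk hL hβ,
    (tendsto_affine_log_atTop (b := 1 / p) (by positivity) κ).eventually
      (hev.and (eventually_gt_atTop 0))] with n h1 h2 h3
  rw [e] at h2
  exact (le_inv_mul_log_iff h1 _ _).2
    (h2 ((le_inv_mul_log_iff h3.2 _ _).1 (by push_cast; exact h3.1.le)))

end Rates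

/-! ### Truncated and exponential moments under a weak tail bound. -/

section Moments

variable {Ω : Type*} [MeasurableSpace Ω] {P : Measure Ω} [IsProbabilityMeasure P]
  {X : Ω → ℝ} {p C : ℝ}

/-- Layer cake: the integral is at most `C * q * ∫ t ^ (q - p - 1)` over `(0, y]`, finite since `q >
p`. -/
lemma integral_min_rpow_le (hm : Measurable X) (h0 : ∀ ω, 0 ≤ X ω) (hC : 0 ≤ C)
    (htail : ∀ t, 0 < t → P.real {ω | t < X ω} ≤ C * t ^ (-p)) {q y : ℝ} (hq : 0 < q)
    (hpq : p < q) (hy : 0 < y) :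
    ∫ ω, (min (X ω) y) ^ q ∂P ≤ C * q / (q - p) * y ^ (q - p) := by
  have hqp : 0 < q - p := sub_pos.2 hpq
  have hmin0 : ∀ ω, 0 ≤ min (X ω) y := fun ω => le_min (h0 ω) hy.le
  have hmm : Measurable fun ω => min (X ω) y := hm.min measurable_const
  rw [integral_eq_lintegral_of_nonneg_ae (ae_of_all _ fun ω => Real.rpow_nonneg (hmin0 ω) _)
    (hmm.pow_const q).aestronglyMeasurable]
  refine ENNReal.toReal_le_of_le_ofReal (by positivity) ?_
  rw [lintegral_rpow_eq_lintegral_meas_lt_mul P (ae_of_all _ hmin0) hmm.aemeasurable hq]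
  have h1 : ∫⁻ t in Set.Ioi 0, P {a | t < min (X a) y} * ENNReal.ofReal (t ^ (q - 1)) ≤
      ∫⁻ t in Set.Ioc 0 y, ENNReal.ofReal (C * t ^ (q - p - 1)) := by
    rw [← lintegral_indicator measurableSet_Ioi, ← lintegral_indicator measurableSet_Ioc]
    refine lintegral_mono fun t => ?_
    by_cases ht : 0 < t
    · rw [Set.indicator_of_mem (by exact ht)]
      by_cases hty : t ≤ y
      · rw [Set.indicator_of_mem (by exact ⟨ht, hty⟩)]
        calc P {a | t < min (X a) y} * ENNReal.ofReal (t ^ (q - 1))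
            ≤ ENNReal.ofReal (C * t ^ (-p)) * ENNReal.ofReal (t ^ (q - 1)) := by
              gcongr
              rw [← ofReal_measureReal]
              refine ENNReal.ofReal_le_ofReal ((measureReal_mono ?_).trans (htail t ht))
              exact fun ω (hω : t < min (X ω) y) => (lt_min_iff.1 hω).1
          _ = _ := by
              rw [← ENNReal.ofReal_mul (by positivity), mul_assoc, ← Real.rpow_add ht]
              congr 3; ring
      · have : {a | t < min (X a) y} = ∅ := by
          refine Set.eq_empty_of_forall_notMem fun ω (hω : t < min (X ω) y) => ?_
          exact hty (lt_min_iff.1 hω).2.le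
        rw [this, measure_empty, zero_mul]
        exact zero_le
    · rw [Set.indicator_of_notMem (by exact ht)]; exact zero_le
  have h2 : ∫⁻ t in Set.Ioc 0 y, ENNReal.ofReal (C * t ^ (q - p - 1)) =
      ENNReal.ofReal (C * (y ^ (q - p) / (q - p))) := by
    have hint : IntervalIntegrable (fun t : ℝ => t ^ (q - p - 1)) volume 0 y :=
      intervalIntegral.intervalIntegrable_rpow' (by linarith)
    rw [← ofReal_integral_eq_lintegral_ofReal]
    · rw [integral_const_mul, ← intervalIntegral.integral_of_le hy.le,
        integral_rpow (Or.inl (by linarith)), sub_add_cancel, Real.zero_rpow hqp.ne', sub_zero]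
    · exact ((intervalIntegrable_iff_integrableOn_Ioc_of_le hy.le).1 hint).const_mul C
    · filter_upwards [ae_restrict_mem measurableSet_Ioc] with t ht
      exact mul_nonneg hC (Real.rpow_nonneg ht.1.le _)
  calc _ ≤ ENNReal.ofReal q * ENNReal.ofReal (C * (y ^ (q - p) / (q - p))) := by
        rw [← h2]; gcongr
    _ = _ := by
        rw [← ENNReal.ofReal_mul hq.le]; congr 1; field_simp

lemma integral_max_sub_le (hm : Measurable X) (hC : 0 ≤ C)
    (htail : ∀ t, 0 < t → P.real {ω | t < X ω} ≤ C * t ^ (-p)) (hp : 1 < p) {x : ℝ} (hx : 0 < x) :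
    ∫ ω, max (X ω - x) 0 ∂P ≤ C / (p - 1) * x ^ (1 - p) := by
  have hp1 : 0 < p - 1 := sub_pos.2 hp
  have hmm : Measurable fun ω => max (X ω - x) 0 := (hm.sub_const x).max measurable_const
  have hnn : ∀ ω, 0 ≤ max (X ω - x) 0 := fun ω => le_max_right _ _
  rw [integral_eq_lintegral_of_nonneg_ae (ae_of_all _ hnn) hmm.aestronglyMeasurable]
  refine ENNReal.toReal_le_of_le_ofReal (by positivity) ?_
  rw [lintegral_eq_lintegral_meas_lt P (ae_of_all _ hnn) hmm.aemeasurable]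
  calc ∫⁻ t in Set.Ioi 0, P {a | t < max (X a - x) 0}
      ≤ ∫⁻ t, (Set.Ioi x).indicator (fun u => ENNReal.ofReal (C * u ^ (-p))) (t + x) := by
        rw [← lintegral_indicator measurableSet_Ioi]
        refine lintegral_mono fun t => ?_
        by_cases ht : 0 < t
        · rw [Set.indicator_of_mem (by exact ht), Set.indicator_of_mem (by simpa using ht),
            ← ofReal_measureReal]
          refine ENNReal.ofReal_le_ofReal ((measureReal_mono ?_).trans (htail _ (by positivity)))
          intro ω hω
          rcases lt_max_iff.1 (show t < max (X ω - x) 0 from hω) with h | h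
          · exact lt_sub_iff_add_lt.1 h
          · exact absurd h ht.le.not_gt
        · rw [Set.indicator_of_notMem (by exact ht)]; exact zero_le
    _ = ∫⁻ u in Set.Ioi x, ENNReal.ofReal (C * u ^ (-p)) := by
        rw [lintegral_add_right_eq_self
          ((Set.Ioi x).indicator (fun u => ENNReal.ofReal (C * u ^ (-p)))) x,
          lintegral_indicator measurableSet_Ioi]
    _ = ENNReal.ofReal (C * (x ^ (1 - p) / (p - 1))) := by
        rw [← ofReal_integral_eq_lintegral_ofReal]
        · rw [integral_const_mul, integral_Ioi_rpow_of_lt (by linarith) hx]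
          congr 2
          rw [show -p + 1 = 1 - p by ring, ← neg_sub p 1, div_neg, neg_div, neg_neg]
        · exact (integrableOn_Ioi_rpow_of_lt (by linarith) hx).const_mul C
        · filter_upwards [ae_restrict_mem measurableSet_Ioi] with t ht
          exact mul_nonneg hC (Real.rpow_nonneg (hx.trans ht).le _)
    _ ≤ _ := le_of_eq (by congr 1; ring)

lemma exp_le_one_add_add_sq {u : ℝ} (hu : |u| ≤ 1) : Real.exp u ≤ 1 + u + u ^ 2 := by
  have := (abs_le.1 (Real.abs_exp_sub_one_sub_id_le hu)).2
  linarith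

lemma integrable_min_of_nonneg (hm : Measurable X) (h0 : ∀ ω, 0 ≤ X ω) {y : ℝ} (hy : 0 < y)
    (f : ℝ → ℝ) (hf : Continuous f) : Integrable (fun ω => f (min (X ω) y)) P := by
  obtain ⟨B, hB⟩ := (isCompact_Icc (a := (0 : ℝ)) (b := y)).exists_bound_of_continuousOn
    hf.continuousOn
  refine Integrable.of_bound (hf.measurable.comp (hm.min measurable_const)).aestronglyMeasurable B
    (ae_of_all _ fun ω => hB _ ⟨le_min (h0 ω) hy.le, min_le_right _ _⟩)

/-- For `p < 1` the first truncated moment suffices, as `exp u ≤ 1 + 2 * u` on `[0, 1]`. The terms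
`l * 0` and `l ^ (1 : ℝ)` fit the common shape `l * m + D * l ^ q * y ^ (q - p)` with `m = 0`, `q =
1`. -/
lemma integral_exp_mul_min_le_of_lt_one (hm : Measurable X) (h0 : ∀ ω, 0 ≤ X ω) (hC : 0 ≤ C)
    (htail : ∀ t, 0 < t → P.real {ω | t < X ω} ≤ C * t ^ (-p)) (hp : p < 1) {l y : ℝ}
    (hl : 0 < l) (hy : 0 < y) (hly : l * y ≤ 1) :
    ∫ ω, Real.exp (l * min (X ω) y) ∂P ≤
      Real.exp (l * 0 + 2 * (C / (1 - p)) * l ^ (1 : ℝ) * y ^ (1 - p)) := by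
  have hM := integral_min_rpow_le hm h0 hC htail one_pos hp hy
  simp only [Real.rpow_one, mul_one] at hM ⊢
  have hi : Integrable (fun ω => min (X ω) y) P :=
    integrable_min_of_nonneg hm h0 hy id continuous_id
  calc ∫ ω, Real.exp (l * min (X ω) y) ∂P ≤ ∫ ω, (1 + 2 * l * min (X ω) y) ∂P := by
        refine integral_mono (integrable_min_of_nonneg hm h0 hy (fun u => Real.exp (l * u))
          (by fun_prop)) (integrable_min_of_nonneg hm h0 hy (fun u => 1 + 2 * l * u)
          (by fun_prop)) fun ω => ?_
        have h1 : 0 ≤ l * min (X ω) y := mul_nonneg hl.le (le_min (h0 ω) hy.le)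
        have h2 : l * min (X ω) y ≤ 1 := le_trans (by gcongr; exact min_le_right _ _) hly
        have := exp_le_one_add_add_sq (abs_le.2 ⟨by linarith, h2⟩)
        simp only
        nlinarith
    _ = 1 + 2 * l * ∫ ω, min (X ω) y ∂P := by
        rw [integral_add (integrable_const _) (hi.const_mul _), integral_const_mul]; simp
    _ ≤ 1 + 2 * l * (C / (1 - p) * y ^ (1 - p)) := by gcongr
    _ ≤ Real.exp (2 * l * (C / (1 - p) * y ^ (1 - p))) := by
        rw [add_comm]; exact Real.add_one_le_exp _
    _ = _ := by congr 1; ring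

/-- Same shape with `q = 2`: the linear term is kept exactly for the centering, and only the
quadratic one uses the tail. -/
lemma integral_exp_mul_min_le_of_lt_two (hm : Measurable X) (h0 : ∀ ω, 0 ≤ X ω) (hC : 0 ≤ C)
    (htail : ∀ t, 0 < t → P.real {ω | t < X ω} ≤ C * t ^ (-p)) (hp : p < 2)
    (hX : Integrable X P) {l y : ℝ} (hl : 0 < l) (hy : 0 < y) (hly : l * y ≤ 1) :
    ∫ ω, Real.exp (l * min (X ω) y) ∂P ≤
      Real.exp (l * (∫ ω, X ω ∂P) + C * 2 / (2 - p) * l ^ (2 : ℝ) * y ^ (2 - p)) := by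
  have hM := integral_min_rpow_le hm h0 hC htail two_pos hp hy
  simp only [Real.rpow_two] at hM ⊢
  have hi2 := integrable_min_of_nonneg (P := P) hm h0 hy (fun u => u ^ 2) (by fun_prop)
  have hs : Integrable (fun ω => l * X ω + l ^ 2 * (min (X ω) y) ^ 2) P :=
    (hX.const_mul _).add (hi2.const_mul _)
  calc ∫ ω, Real.exp (l * min (X ω) y) ∂P
      ≤ ∫ ω, (1 + (l * X ω + l ^ 2 * (min (X ω) y) ^ 2)) ∂P := by
        refine integral_mono (integrable_min_of_nonneg hm h0 hy (fun u => Real.exp (l * u))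
          (by fun_prop)) ((integrable_const _).add hs)
          fun ω => ?_
        have h1 : 0 ≤ l * min (X ω) y := mul_nonneg hl.le (le_min (h0 ω) hy.le)
        have h2 : l * min (X ω) y ≤ 1 := le_trans (by gcongr; exact min_le_right _ _) hly
        have h3 : l * min (X ω) y ≤ l * X ω := by gcongr; exact min_le_left _ _
        have := exp_le_one_add_add_sq (abs_le.2 ⟨by linarith, h2⟩)
        simp only
        linarith [mul_pow l (min (X ω) y) 2]
    _ = 1 + (l * (∫ ω, X ω ∂P) + l ^ 2 * ∫ ω, (min (X ω) y) ^ 2 ∂P) := by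
        rw [integral_add (integrable_const _) hs,
          integral_add (hX.const_mul _) (hi2.const_mul _), integral_const_mul, integral_const_mul]
        simp
    _ ≤ 1 + (l * (∫ ω, X ω ∂P) + l ^ 2 * (C * 2 / (2 - p) * y ^ (2 - p))) := by gcongr
    _ ≤ Real.exp (l * (∫ ω, X ω ∂P) + l ^ 2 * (C * 2 / (2 - p) * y ^ (2 - p))) := by
        rw [add_comm]; exact Real.add_one_le_exp _
    _ = _ := by congr 1; ring

/-- Split at `1 / l`: below it expand to second order; above it use `exp (-l * X) ≤ 1`, where the
excess `l * (X - 1 / l)` compensates the linear term. Both errors are of order `l ^ p`; the excess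
needs `p > 1`. -/
lemma integral_exp_neg_mul_le (hm : Measurable X) (h0 : ∀ ω, 0 ≤ X ω) (hC : 0 ≤ C)
    (htail : ∀ t, 0 < t → P.real {ω | t < X ω} ≤ C * t ^ (-p)) (hp1 : 1 < p) (hp : p < 2)
    (hX : Integrable X P) {l : ℝ} (hl : 0 < l) :
    ∫ ω, Real.exp (-l * X ω) ∂P ≤
      Real.exp (-l * (∫ ω, X ω ∂P) + (C * 2 / (2 - p) + C / (p - 1)) * l ^ p) := by
  have hx : 0 < l⁻¹ := inv_pos.2 hl
  have hM := integral_min_rpow_le hm h0 hC htail two_pos hp hx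
  have hM2 := integral_max_sub_le hm hC htail hp1 hx
  simp only [Real.rpow_two] at hM
  have hi2 := integrable_min_of_nonneg (P := P) hm h0 hx (fun u => u ^ 2) (by fun_prop)
  have hi3 : Integrable (fun ω => max (X ω - l⁻¹) 0) P :=
    (hX.sub (integrable_const _)).sup (integrable_const 0)
  have hs2 : Integrable (fun ω => l ^ 2 * (min (X ω) l⁻¹) ^ 2 + l * max (X ω - l⁻¹) 0) P :=
    (hi2.const_mul _).add (hi3.const_mul _)
  have hs : Integrable (fun ω => -l * X ω +
      (l ^ 2 * (min (X ω) l⁻¹) ^ 2 + l * max (X ω - l⁻¹) 0)) P := (hX.const_mul _).add hs2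
  have hie : Integrable (fun ω => Real.exp (-l * X ω)) P := by
    refine Integrable.of_bound (by fun_prop) 1 (ae_of_all _ fun ω => ?_)
    rw [Real.norm_eq_abs, abs_of_pos (Real.exp_pos _), Real.exp_le_one_iff]
    nlinarith [h0 ω]
  calc ∫ ω, Real.exp (-l * X ω) ∂P
      ≤ ∫ ω, (1 + (-l * X ω + (l ^ 2 * (min (X ω) l⁻¹) ^ 2 + l * max (X ω - l⁻¹) 0))) ∂P := by
        refine integral_mono hie ((integrable_const _).add hs) fun ω => ?_
        simp only
        rcases le_total (X ω) l⁻¹ with h | h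
        · have h1 : l * X ω ≤ 1 := by
            calc l * X ω ≤ l * l⁻¹ := by gcongr
              _ = 1 := mul_inv_cancel₀ hl.ne'
          have h2 : 0 ≤ l * X ω := mul_nonneg hl.le (h0 ω)
          have := exp_le_one_add_add_sq (u := -l * X ω) (abs_le.2 ⟨by linarith, by linarith⟩)
          rw [min_eq_left h, max_eq_right (by linarith)]
          nlinarith
        · have h1 : Real.exp (-l * X ω) ≤ 1 := Real.exp_le_one_iff.2 (by nlinarith [h0 ω])
          rw [min_eq_right h, max_eq_left (by linarith), mul_sub, mul_inv_cancel₀ hl.ne',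
            inv_pow, mul_inv_cancel₀ (by positivity)]
          linarith
    _ = 1 + (-l * (∫ ω, X ω ∂P) + (l ^ 2 * ∫ ω, (min (X ω) l⁻¹) ^ 2 ∂P +
          l * ∫ ω, max (X ω - l⁻¹) 0 ∂P)) := by
        rw [integral_add (integrable_const _) hs, integral_add (hX.const_mul _) hs2, integral_add (hi2.const_mul _)
          (hi3.const_mul _), integral_const_mul, integral_const_mul, integral_const_mul]
        simp
    _ ≤ 1 + (-l * (∫ ω, X ω ∂P) + (l ^ 2 * (C * 2 / (2 - p) * l⁻¹ ^ (2 - p)) +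
          l * (C / (p - 1) * l⁻¹ ^ (1 - p)))) := by gcongr
    _ ≤ Real.exp (-l * (∫ ω, X ω ∂P) + (l ^ 2 * (C * 2 / (2 - p) * l⁻¹ ^ (2 - p)) +
          l * (C / (p - 1) * l⁻¹ ^ (1 - p)))) := by
        rw [add_comm]; exact Real.add_one_le_exp _
    _ = _ := by
        have e1 : l ^ 2 * l⁻¹ ^ (2 - p) = l ^ p := by
          rw [Real.inv_rpow hl.le, ← Real.rpow_neg hl.le, ← Real.rpow_two, ← Real.rpow_add hl]
          congr 1; ring
        have e2 : l * l⁻¹ ^ (1 - p) = l ^ p := by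
          rw [Real.inv_rpow hl.le, ← Real.rpow_neg hl.le]
          nth_rewrite 1 [← Real.rpow_one l]
          rw [← Real.rpow_add hl]
          congr 1; ring
        congr 1
        linear_combination (C * 2 / (2 - p)) * e1 + (C / (p - 1)) * e2

end Moments

/-! ### Chernoff upper bound, single-jump lower bound, lower deviations. -/

section Sums

variable {Ω : Type*} [MeasurableSpace Ω] {P : Measure Ω} [IsProbabilityMeasure P]

lemma measureReal_le_sum_le_exp {Z : ℕ → Ω → ℝ} (hm : ∀ i, Measurable (Z i)) (hind : iIndepFun Z P)
    {l b : ℝ} (hl : 0 ≤ l) (hint : ∀ i, Integrable (fun ω => Real.exp (l * Z i ω)) P)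
    (hmgf : ∀ i, ∫ ω, Real.exp (l * Z i ω) ∂P ≤ Real.exp b) (J : Finset ℕ) (a : ℝ) :
    P.real {ω | a ≤ ∑ i ∈ J, Z i ω} ≤ Real.exp (-l * a + J.card * b) := by
  have h1 := measure_ge_le_exp_mul_mgf (X := ∑ i ∈ J, Z i) (μ := P) a hl
    (hind.integrable_exp_mul_sum hm fun i _ => hint i)
  rw [hind.mgf_sum hm] at h1
  simp only [Finset.sum_apply] at h1
  refine h1.trans ?_
  rw [Real.exp_add, Real.exp_nat_mul]
  gcongr
  rw [← Finset.prod_const]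
  exact Finset.prod_le_prod (fun i _ => mgf_nonneg) fun i _ => hmgf i

variable {Y : ℕ → Ω → ℝ} {p : ℝ}

lemma measure_lt_sum_le (hm : ∀ i, Measurable (Y i)) (h0 : ∀ i ω, 0 ≤ Y i ω) (hind : iIndepFun Y P)
    (hid : ∀ i, IdentDistrib (Y i) (Y 0) P P) (hp : 0 < p) {q m D : ℝ} (hpq : p < q)
    (hmgf : ∀ l y, 0 < l → 0 < y → l * y ≤ 1 → ∫ ω, Real.exp (l * min (Y 0 ω) y) ∂P ≤
      Real.exp (l * m + D * l ^ q * y ^ (q - p))) (s : ℝ) (n : ℕ) (hn : 1 ≤ n) (t : ℝ)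
    (ht : t ≤ Real.log n / p) :
    P {ω | n * m + s * (n : ℝ) ^ (1 / p) < partialSum Y n ω} ≤
      n * P {ω | Real.exp t < Y 0 ω} +
        ENNReal.ofReal (Real.exp (D - s * Real.exp ((1 - p / q) * (Real.log n / p - t)))) := by
  set L := Real.log n with hLdef
  have hn0 : (0 : ℝ) < n := by exact_mod_cast hn
  have hq : 0 < q := hp.trans hpq
  set y := Real.exp t with hy
  have hy0 : 0 < y := Real.exp_pos t
  -- This `l` solves `n * l ^ q * y ^ (q - p) = 1`, so the error in the exponent totals just `D`;
  -- the constraint `l * y ≤ 1` then amounts to `t ≤ L / p`.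
  set l := Real.exp ((p / q - 1) * t - L / q) with hl
  have hl0 : 0 < l := Real.exp_pos _
  have hly : l * y ≤ 1 := by
    rw [hl, hy, ← Real.exp_add, Real.exp_le_one_iff]
    rw [le_div_iff₀ hp] at ht
    have : (p / q - 1) * t - L / q + t = (t * p - L) / q := by field_simp; ring
    rw [this]
    exact div_nonpos_of_nonpos_of_nonneg (by linarith) hq.le
  have hx : (n : ℝ) ^ (1 / p) = Real.exp (L / p) := by
    rw [Real.rpow_def_of_pos hn0]; congr 1; ring
  have hlx : l * (n : ℝ) ^ (1 / p) = Real.exp ((1 - p / q) * (L / p - t)) := by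
    rw [hx, hl, ← Real.exp_add]; congr 1; field_simp; ring
  have hone : n * (l ^ q * y ^ (q - p)) = 1 := by
    rw [hl, hy, ← Real.exp_mul, ← Real.exp_mul, ← Real.exp_add]
    nth_rewrite 1 [← Real.exp_log hn0]
    rw [← Real.exp_add, Real.exp_eq_one_iff, ← hLdef]
    field_simp; ring
  set Z : ℕ → Ω → ℝ := fun i ω => min (Y i ω) y with hZ
  have hZm : ∀ i, Measurable (Z i) := fun i => (hm i).min measurable_const
  have hZind : iIndepFun Z P :=
    hind.comp (fun _ u => min u y) fun _ => measurable_id.min measurable_const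
  have hZmgf : ∀ i, ∫ ω, Real.exp (l * Z i ω) ∂P ≤
      Real.exp (l * m + D * l ^ q * y ^ (q - p)) := by
    intro i
    refine le_trans (le_of_eq ?_) (hmgf l y hl0 hy0 hly)
    exact ((hid i).comp (u := fun u => Real.exp (l * min u y)) (by fun_prop)).integral_eq
  have hch := measureReal_le_sum_le_exp hZm hZind hl0.le
    (fun i => integrable_min_of_nonneg (hm i) (h0 i) hy0 (fun u => Real.exp (l * u))
      (by fun_prop)) hZmgf (Finset.range n) (n * m + s * (n : ℝ) ^ (1 / p))
  have e : -l * (n * m + s * (n : ℝ) ^ (1 / p)) + ((Finset.range n).card : ℝ) *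
      (l * m + D * l ^ q * y ^ (q - p)) =
      D - s * Real.exp ((1 - p / q) * (L / p - t)) := by
    rw [← hlx, Finset.card_range]
    linear_combination D * hone
  rw [e] at hch
  have hsub : {ω | n * m + s * (n : ℝ) ^ (1 / p) < partialSum Y n ω} ⊆
      (⋃ i ∈ Finset.range n, {ω | y < Y i ω}) ∪
        {ω | n * m + s * (n : ℝ) ^ (1 / p) ≤ ∑ i ∈ Finset.range n, Z i ω} := by
    intro ω hω
    by_cases h : ∃ i ∈ Finset.range n, y < Y i ω
    · left
      obtain ⟨i, hi, hy⟩ := h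
      exact Set.mem_biUnion hi hy
    · right
      push Not at h
      have hω' : n * m + s * (n : ℝ) ^ (1 / p) < ∑ i ∈ Finset.range n, Y i ω := hω
      refine hω'.le.trans (le_of_eq (Finset.sum_congr rfl fun i hi => ?_))
      exact (min_eq_left (h i hi)).symm
  refine (measure_mono hsub).trans ((measure_union_le _ _).trans (add_le_add ?_ ?_))
  · refine (measure_biUnion_finset_le _ _).trans (le_of_eq ?_)
    have hyi : ∀ i, P {ω | y < Y i ω} = P {ω | y < Y 0 ω} := fun i =>
      (hid i).measure_mem_eq (measurableSet_Ioi (a := y))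
    rw [Finset.sum_congr rfl fun i _ => hyi i, Finset.sum_const, Finset.card_range, nsmul_eq_mul]
  · rw [← ofReal_measureReal]
    exact ENNReal.ofReal_le_ofReal hch

/-- One of the summands exceeds `K x` while the others make up for the centering. -/
lemma le_measure_lt_sum (hm : ∀ i, Measurable (Y i)) (hind : iIndepFun Y P)
    (hid : ∀ i, IdentDistrib (Y i) (Y 0) P P) {u v w : ℝ} {n : ℕ}
    (hsmall : n * P.real {ω | v < Y 0 ω} ≤ 1 / 4)
    (hlow : ∀ J : Finset ℕ, J.card + 1 = n → P.real {ω | ∑ i ∈ J, Y i ω ≤ w} ≤ 1 / 2)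
    (huvw : u ≤ v + w) :
    1 / 4 * n * P.real {ω | v < Y 0 ω} ≤ P.real {ω | u < partialSum Y n ω} := by
  set G := P.real {ω | v < Y 0 ω} with hG
  have hGi : ∀ i, P.real {ω | v < Y i ω} = G := fun i => by
    rw [hG, measureReal_def, measureReal_def]
    exact congrArg _ ((hid i).measure_mem_eq (measurableSet_Ioi (a := v)))
  let J : ℕ → Finset ℕ := fun i => (Finset.range n).erase i
  -- `R i` involves only the other summands, hence is independent of `Y i`; its first clause makes
  -- the events `D i` disjoint.
  let R : ℕ → Set Ω := fun i => {ω | (∀ j ∈ J i, Y j ω ≤ v) ∧ w < ∑ j ∈ J i, Y j ω}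
  let D : ℕ → Set Ω := fun i => {ω | v < Y i ω} ∩ R i
  have hRm : ∀ i, MeasurableSet (R i) := fun i => by
    refine MeasurableSet.inter (s₁ := {ω | ∀ j ∈ J i, Y j ω ≤ v}) ?_
      (measurableSet_lt measurable_const (Finset.measurable_sum _ fun j _ => hm j))
    have : {ω | ∀ j ∈ J i, Y j ω ≤ v} = ⋂ j ∈ J i, {ω | Y j ω ≤ v} := by ext; simp
    rw [this]
    exact Finset.measurableSet_biInter _ fun j _ => measurableSet_le (hm j) measurable_const
  have hDm : ∀ i, MeasurableSet (D i) := fun i =>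
    (measurableSet_lt measurable_const (hm i)).inter (hRm i)
  -- `1 / 4 = 1 - 1 / 4 - 1 / 2`, by `hsmall` and `hlow`.
  have hR : ∀ i ∈ Finset.range n, 1 / 4 ≤ P.real (R i) := by
    intro i hi
    have hcard : (J i).card + 1 = n := by
      have := Finset.card_erase_add_one hi
      rwa [Finset.card_range] at this
    have hc : (R i)ᶜ ⊆ (⋃ j ∈ J i, {ω | v < Y j ω}) ∪ {ω | ∑ j ∈ J i, Y j ω ≤ w} := by
      intro ω hω
      by_cases h : ∀ j ∈ J i, Y j ω ≤ v
      · exact Or.inr (not_lt.1 fun h' => hω ⟨h, h'⟩)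
      · push Not at h
        obtain ⟨j, hj, h⟩ := h
        exact Or.inl (Set.mem_biUnion hj h)
    have h1 : P.real (⋃ j ∈ J i, {ω | v < Y j ω}) ≤ n * G := by
      refine (measureReal_biUnion_finset_le _ _).trans ?_
      rw [Finset.sum_congr rfl fun j _ => hGi j, Finset.sum_const, nsmul_eq_mul]
      have : ((J i).card : ℝ) ≤ n := by exact_mod_cast (by omega : (J i).card ≤ n)
      have : 0 ≤ G := measureReal_nonneg
      gcongr
    have h2 := (measureReal_mono (μ := P) hc).trans (measureReal_union_le _ _)
    rw [probReal_compl_eq_one_sub (hRm i)] at h2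
    linarith [hlow (J i) hcard]
  have hD : ∀ i ∈ Finset.range n, 1 / 4 * G ≤ P.real (D i) := by
    intro i hi
    have hI := hind.indepFun_finset {i} (J i) (by simp [J]) hm
    have hA : MeasurableSet {f : ({i} : Finset ℕ) → ℝ | v < f ⟨i, by simp⟩} :=
      measurableSet_lt measurable_const (measurable_pi_apply _)
    have hB : MeasurableSet {f : J i → ℝ | (∀ j, f j ≤ v) ∧ w < ∑ j, f j} := by
      refine MeasurableSet.inter (s₁ := {f : J i → ℝ | ∀ j, f j ≤ v}) ?_
        (measurableSet_lt measurable_const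
          (Finset.measurable_sum _ fun j _ => measurable_pi_apply j))
      have : {f : J i → ℝ | ∀ j, f j ≤ v} = ⋂ j, {f | f j ≤ v} := by ext; simp
      rw [this]
      exact MeasurableSet.iInter fun j => measurableSet_le (measurable_pi_apply j) measurable_const
    have hmul := hI.measure_inter_preimage_eq_mul _ _ hA hB
    have eA : (fun a (k : ({i} : Finset ℕ)) => Y k a) ⁻¹'
        {f : ({i} : Finset ℕ) → ℝ | v < f ⟨i, by simp⟩} = {ω | v < Y i ω} := rfl
    have eB : (fun a (k : J i) => Y k a) ⁻¹' {f : J i → ℝ | (∀ j, f j ≤ v) ∧ w < ∑ j, f j} =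
        R i := by
      ext ω
      have hsum : ∑ j : J i, Y j ω = ∑ j ∈ J i, Y j ω := Finset.sum_coe_sort (J i) fun j => Y j ω
      change ((∀ j : J i, Y j ω ≤ v) ∧ w < ∑ j : J i, Y j ω) ↔
        ((∀ j ∈ J i, Y j ω ≤ v) ∧ w < ∑ j ∈ J i, Y j ω)
      rw [hsum]
      simp only [Subtype.forall]
    rw [eA, eB] at hmul
    have : P.real (D i) = G * P.real (R i) := by
      rw [measureReal_def, hmul, ENNReal.toReal_mul, ← measureReal_def, ← measureReal_def, hGi]
    rw [this, mul_comm]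
    have : 0 ≤ G := measureReal_nonneg
    have := hR i hi
    gcongr
  have hdisj : Set.PairwiseDisjoint (↑(Finset.range n)) D := by
    intro i hi j hj hij
    refine Set.disjoint_left.2 fun ω hωi hωj => ?_
    have : Y i ω ≤ v := hωj.2.1 i (Finset.mem_erase.2 ⟨hij, hi⟩)
    exact absurd hωi.1 this.not_gt
  have hsub : (⋃ i ∈ Finset.range n, D i) ⊆ {ω | u < partialSum Y n ω} := by
    intro ω hω
    obtain ⟨i, hi, hv, -, hw⟩ := by simpa only [Set.mem_iUnion₂] using hω
    have hv' : v < Y i ω := hv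
    have : partialSum Y n ω = Y i ω + ∑ j ∈ J i, Y j ω :=
      (Finset.add_sum_erase _ (fun j => Y j ω) hi).symm
    change u < partialSum Y n ω
    linarith
  calc 1 / 4 * n * G = ∑ _i ∈ Finset.range n, 1 / 4 * G := by
        rw [Finset.sum_const, Finset.card_range, nsmul_eq_mul]; ring
    _ ≤ ∑ i ∈ Finset.range n, P.real (D i) := Finset.sum_le_sum hD
    _ = P.real (⋃ i ∈ Finset.range n, D i) :=
        (measureReal_biUnion_finset hdisj fun i _ => hDm i).symm
    _ ≤ _ := measureReal_mono hsub

/-- The lower deviations of the centered sums of nonnegative variables are tight on the scale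
`n ^ (1 / p)`. -/
lemma exists_forall_measureReal_sum_le (hm : ∀ i, Measurable (Y i)) (h0 : ∀ i ω, 0 ≤ Y i ω)
    (hind : iIndepFun Y P) (hid : ∀ i, IdentDistrib (Y i) (Y 0) P P) (hp : 0 < p) {μ D : ℝ}
    (hμ : 0 ≤ μ) (hmgf : ∀ l, 0 < l → l ≤ 1 → ∫ ω, Real.exp (-l * Y 0 ω) ∂P ≤
      Real.exp (-l * μ + D * l ^ p)) (hD : 0 ≤ D) :
    ∃ M, ∀ n : ℕ, 1 ≤ n → ∀ J : Finset ℕ, J.card + 1 = n →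
      P.real {ω | ∑ i ∈ J, Y i ω ≤ n * μ - M * (n : ℝ) ^ (1 / p)} ≤ 1 / 2 := by
  -- In Chernoff with `l = n ^ (-1 / p)`, `D` covers the total error, `μ` the missing summand (`J`
  -- has `n - 1` elements), and `1` leaves `exp (-1) ≤ 1 / 2`.
  refine ⟨μ + D + 1, fun n hn J hJ => ?_⟩
  have hn1 : (1 : ℝ) ≤ n := by exact_mod_cast hn
  have hx : 1 ≤ (n : ℝ) ^ (1 / p) := Real.one_le_rpow hn1 (by positivity)
  set x := (n : ℝ) ^ (1 / p) with hxdef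
  have hx0 : 0 < x := by linarith
  set l := x⁻¹ with hl
  have hl0 : 0 < l := inv_pos.2 hx0
  have hl1 : l ≤ 1 := inv_le_one_of_one_le₀ hx
  have hlx : l * x = 1 := inv_mul_cancel₀ hx0.ne'
  have hone : n * l ^ p = 1 := by
    rw [hl, Real.inv_rpow hx0.le, hxdef, ← Real.rpow_mul (by linarith), one_div,
      inv_mul_cancel₀ hp.ne', Real.rpow_one, mul_inv_cancel₀ (by linarith)]
  have hint : ∀ i, Integrable (fun ω => Real.exp (l * -Y i ω)) P := fun i => by
    have := hm i
    refine Integrable.of_bound (by fun_prop) 1 (ae_of_all _ fun ω => ?_)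
    rw [Real.norm_eq_abs, abs_of_pos (Real.exp_pos _), Real.exp_le_one_iff]
    nlinarith [h0 i ω]
  have hZmgf : ∀ i, ∫ ω, Real.exp (l * -Y i ω) ∂P ≤ Real.exp (-l * μ + D * l ^ p) := by
    intro i
    refine le_trans (le_of_eq ?_) (hmgf l hl0 hl1)
    refine (((hid i).comp (u := fun u => Real.exp (l * -u)) (by fun_prop)).integral_eq).trans ?_
    simp only [Function.comp_def, mul_neg, neg_mul]
  have hch := measureReal_le_sum_le_exp (Z := fun i ω => -Y i ω) (fun i => (hm i).neg)
    (hind.comp (fun _ u => -u) fun _ => measurable_neg) hl0.le hint hZmgf J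
    (-(n * μ - (μ + D + 1) * x))
  have e : {ω | ∑ i ∈ J, Y i ω ≤ n * μ - (μ + D + 1) * x} =
      {ω | -(n * μ - (μ + D + 1) * x) ≤ ∑ i ∈ J, -Y i ω} := by
    ext ω
    change ∑ i ∈ J, Y i ω ≤ n * μ - (μ + D + 1) * x ↔
      -(n * μ - (μ + D + 1) * x) ≤ ∑ i ∈ J, -Y i ω
    rw [Finset.sum_neg_distrib, neg_le_neg_iff]
  rw [e]
  refine hch.trans ?_
  have hJn : (J.card : ℝ) = n - 1 := by rw [← hJ]; push_cast; ring
  have h2 : -l * -(n * μ - (μ + D + 1) * x) + J.card * (-l * μ + D * l ^ p) ≤ -1 := by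
    rw [hJn]
    have h3 : 0 ≤ D * l ^ p := by positivity
    have h4 : l * μ ≤ μ := mul_le_of_le_one_left hμ hl1
    have h5 : -l * -(n * μ - (μ + D + 1) * x) + (n - 1) * (-l * μ + D * l ^ p) =
      -(μ + D + 1) * (l * x) + l * μ + D * (n * l ^ p) - D * l ^ p := by ring
    rw [h5, hlx, hone]; linarith
  refine (Real.exp_le_exp.2 h2).trans ?_
  rw [Real.exp_neg, one_div]
  gcongr
  linarith [Real.add_one_le_exp (1 : ℝ)]

/-- A weak tail bound on the scale `n ^ (1 / p)` interpolates to all real arguments. -/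
lemma exists_measureReal_lt_le_rpow {X : Ω → ℝ} (hp : 0 < p)
    (h : Tendsto (fun n : ℕ => (n : ℝ≥0∞) * P {ω | (n : ℝ) ^ (1 / p) < X ω}) atTop (𝓝 0)) :
    ∃ C, 0 ≤ C ∧ ∀ t, 0 < t → P.real {ω | t < X ω} ≤ C * t ^ (-p) := by
  obtain ⟨N, hN⟩ := eventually_atTop.1 (h.eventually_le_const zero_lt_one)
  have hB : ∀ n : ℕ, n * P.real {ω | (n : ℝ) ^ (1 / p) < X ω} ≤ N + 1 := by
    intro n
    rcases le_total N n with hn | hn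
    · have h1 := ENNReal.toReal_mono ENNReal.one_ne_top (hN n hn)
      rw [ENNReal.toReal_mul, ENNReal.toReal_natCast, ENNReal.toReal_one] at h1
      have : (0 : ℝ) ≤ N := Nat.cast_nonneg N
      rw [measureReal_def]
      linarith
    · have h1 : P.real {ω | (n : ℝ) ^ (1 / p) < X ω} ≤ 1 := measureReal_le_one
      have h2 : (n : ℝ) ≤ N := by exact_mod_cast hn
      nlinarith [Nat.cast_nonneg (α := ℝ) n]
  -- The factor `2` comes from `t ^ p ≤ 2 * ⌊t ^ p⌋₊` for `t ≥ 1`.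
  refine ⟨2 * (N + 1), by positivity, fun t ht => ?_⟩
  have hP1 : P.real {ω | t < X ω} ≤ 1 := measureReal_le_one
  have hN0 : (0 : ℝ) ≤ N := Nat.cast_nonneg N
  rw [Real.rpow_neg ht.le, ← div_eq_mul_inv, le_div_iff₀ (by positivity)]
  rcases lt_or_ge t 1 with h1 | h1
  · have : t ^ p ≤ 1 := Real.rpow_le_one ht.le h1.le hp.le
    have : P.real {ω | t < X ω} * t ^ p ≤ 1 * 1 := by gcongr
    linarith
  · have h2 : 1 ≤ t ^ p := Real.one_le_rpow h1 hp.le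
    have h3 : 1 ≤ ⌊t ^ p⌋₊ := Nat.one_le_floor_iff _ |>.2 h2
    have h4 : ((⌊t ^ p⌋₊ : ℕ) : ℝ) ^ (1 / p) ≤ t := by
      calc ((⌊t ^ p⌋₊ : ℕ) : ℝ) ^ (1 / p) ≤ (t ^ p) ^ (1 / p) := by
            gcongr; exact Nat.floor_le (by positivity)
        _ = t := by rw [← Real.rpow_mul ht.le, mul_one_div_cancel hp.ne', Real.rpow_one]
    have h5 : t ^ p ≤ 2 * ⌊t ^ p⌋₊ := by
      have := Nat.lt_floor_add_one (t ^ p)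
      have : (1 : ℝ) ≤ ⌊t ^ p⌋₊ := by exact_mod_cast h3
      linarith
    have h6 : P.real {ω | t < X ω} ≤ P.real {ω | ((⌊t ^ p⌋₊ : ℕ) : ℝ) ^ (1 / p) < X ω} :=
      measureReal_mono fun ω hω => h4.trans_lt hω
    calc P.real {ω | t < X ω} * t ^ p
        ≤ P.real {ω | ((⌊t ^ p⌋₊ : ℕ) : ℝ) ^ (1 / p) < X ω} * (2 * ⌊t ^ p⌋₊) := by gcongr
      _ ≤ _ := by nlinarith [hB ⌊t ^ p⌋₊]

end Sums

/-! ### Assembly of the two regimes. -/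

section Main

variable {Ω : Type*} [MeasurableSpace Ω] {P : Measure Ω}

lemma eventually_tail_eq {X : Ω → ℝ} (h0 : ∀ ω, 0 ≤ X ω) :
    (fun t : ℝ => ((1 / t : ℝ) : EReal) * ENNReal.log (P {ω | t < Real.log (X ω)})) =ᶠ[atTop]
      fun t : ℝ => ((1 / t : ℝ) : EReal) * ENNReal.log (P {ω | Real.exp t < X ω}) := by
  filter_upwards [eventually_gt_atTop 0] with t ht
  have : {ω | t < Real.log (X ω)} = {ω | Real.exp t < X ω} := by
    ext ω
    change t < Real.log (X ω) ↔ Real.exp t < X ω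
    rcases (h0 ω).eq_or_lt with h | h
    · rw [← h, Real.log_zero]
      exact iff_of_false ht.le.not_gt (Real.exp_pos t).le.not_gt
    · exact Real.lt_log_iff_exp_lt h
  rw [this]

/-- Common form of both regimes: `(q, m) = (1, 0)` for `p < 1` and `(2, μ)` for `1 ≤ p < 2`. -/
theorem limsup_liminf_logRate [IsProbabilityMeasure P] {Y : ℕ → Ω → ℝ} (hm : ∀ i, Measurable (Y i))
    (h0 : ∀ i ω, 0 ≤ Y i ω) (hind : iIndepFun Y P) (hid : ∀ i, IdentDistrib (Y i) (Y 0) P P)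
    {p q m D : ℝ} (hp : 0 < p) (hpq : p < q)
    (hmgf : ∀ l y, 0 < l → 0 < y → l * y ≤ 1 → ∫ ω, Real.exp (l * min (Y 0 ω) y) ∂P ≤
      Real.exp (l * m + D * l ^ q * y ^ (q - p)))
    (htail : Tendsto (fun n : ℕ => (n : ℝ≥0∞) * P {ω | (n : ℝ) ^ (1 / p) < Y 0 ω}) atTop (𝓝 0))
    (hlow : ∃ M, ∀ n : ℕ, 1 ≤ n → ∀ J : Finset ℕ, J.card + 1 = n →
      P.real {ω | ∑ i ∈ J, Y i ω ≤ n * m - M * (n : ℝ) ^ (1 / p)} ≤ 1 / 2)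
    {s : ℝ} (hs : 0 < s) :
    limsup (fun n : ℕ => logRate P n {ω | n * m + s * (n : ℝ) ^ (1 / p) < partialSum Y n ω}) atTop
        = -((upperTailExponent P (Y 0) - (p : EReal)) / (p : EReal)) ∧
      liminf (fun n : ℕ => logRate P n {ω | n * m + s * (n : ℝ) ^ (1 / p) < partialSum Y n ω})
        atTop = -((lowerTailExponent P (Y 0) - (p : EReal)) / (p : EReal)) := by
  have hq : 0 < q := hp.trans hpq
  have hc : 0 < 1 - p / q := sub_pos.2 ((div_lt_one hq).2 hpq)
  rw [upperTailExponent, lowerTailExponent, limsup_congr (eventually_tail_eq (h0 0)),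
    liminf_congr (eventually_tail_eq (h0 0))]
  set g : ℝ → ℝ≥0∞ := fun t => P {ω | Real.exp t < Y 0 ω} with hg
  have hanti : Antitone g := fun a b hab =>
    measure_mono fun ω hω => (Real.exp_le_exp.2 hab).trans_lt hω
  have hU := measure_lt_sum_le hm h0 hind hid hp hpq hmgf s
  obtain ⟨M, hM⟩ := hlow
  -- `K ≥ M + s` lets the jump cover both the threshold and the deficit of the other summands; `K ≥
  -- 1` lets the tail hypothesis bound `P(Y 0 > K * x)`.
  set K := max 1 (M + s) with hK
  have hK1 : 1 ≤ K := le_max_left _ _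
  have hL : ∀ᶠ n : ℕ in atTop, ENNReal.ofReal (1 / 4) * n * g (1 / p * Real.log n + Real.log K) ≤
      P {ω | n * m + s * (n : ℝ) ^ (1 / p) < partialSum Y n ω} := by
    filter_upwards [htail.eventually_le_const (show (0 : ℝ≥0∞) < ENNReal.ofReal (1 / 4) by simp),
      eventually_ge_atTop 1] with n h1 hn
    have hn0 : (0 : ℝ) < n := by exact_mod_cast hn
    set x := (n : ℝ) ^ (1 / p) with hx
    have hx0 : 0 < x := by positivity
    have e : Real.exp (1 / p * Real.log n + Real.log K) = K * x := by
      rw [Real.exp_add, Real.exp_log (by linarith), hx, Real.rpow_def_of_pos hn0, mul_comm,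
        mul_comm (1 / p)]
    have hsmall : n * P.real {ω | K * x < Y 0 ω} ≤ 1 / 4 := by
      have h2 := ENNReal.toReal_mono ENNReal.ofReal_ne_top h1
      rw [ENNReal.toReal_mul, ENNReal.toReal_natCast, ENNReal.toReal_ofReal (by norm_num),
        ← measureReal_def] at h2
      refine le_trans ?_ h2
      refine mul_le_mul_of_nonneg_left (measureReal_mono fun ω hω => ?_) hn0.le
      exact lt_of_le_of_lt (le_mul_of_one_le_left hx0.le hK1) hω
    have h3 := le_measure_lt_sum (u := n * m + s * x) hm hind hid hsmall (hM n hn) (by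
      have : M + s ≤ K := le_max_right _ _
      nlinarith)
    have h4 := ENNReal.ofReal_le_ofReal h3
    rw [ENNReal.ofReal_mul (by positivity), ENNReal.ofReal_mul (by positivity), ofReal_measureReal,
      ofReal_measureReal, ENNReal.ofReal_natCast] at h4
    simp only [hg, e]
    exact h4
  have hU' : ∀ n : ℕ, 1 ≤ n → ∀ t : ℝ, 0 ≤ t → t ≤ Real.log n / p → _ :=
    fun n hn t _ ht => hU n hn t ht
  exact ⟨le_antisymm (limsup_rate_le hp hc hs (fun _ => prob_le_one) hU')
      (le_limsup_rate hanti (fun _ => prob_le_one) hp (by norm_num) hL),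
    le_antisymm (liminf_rate_le hanti hp hc hs (fun _ => prob_le_one) hU')
      (le_liminf_rate hp (by norm_num) hL)⟩

lemma tendsto_neg_sub_div_iff {u : ℕ → EReal} {p : ℝ} (hp : 0 < p) {A B : EReal}
    (hA : limsup u atTop = -((A - (p : EReal)) / (p : EReal)))
    (hB : liminf u atTop = -((B - (p : EReal)) / (p : EReal))) (α : EReal) :
    Tendsto u atTop (𝓝 (-((α - (p : EReal)) / (p : EReal)))) ↔ A = α ∧ B = α := by
  constructor
  · intro h
    exact ⟨neg_sub_div_injective hp (hA.symm.trans h.limsup_eq),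
      neg_sub_div_injective hp (hB.symm.trans h.liminf_eq)⟩
  · rintro ⟨rfl, rfl⟩
    exact tendsto_of_liminf_eq_limsup hB hA

/-- An identically distributed sequence with nonnegative law has a version that is measurable and
nonnegative everywhere. -/
lemma exists_measurable_nonneg_version {X : Ω → ℝ} {Xs : ℕ → Ω → ℝ} (hX : ∀ᵐ ω ∂P, 0 ≤ X ω)
    (hident : ∀ n, IdentDistrib (Xs n) X P P) :
    ∃ Y : ℕ → Ω → ℝ, (∀ i, Measurable (Y i)) ∧ (∀ i ω, 0 ≤ Y i ω) ∧ ∀ i, Xs i =ᵐ[P] Y i := by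
  refine ⟨fun i ω => |(hident i).aemeasurable_fst.mk (Xs i) ω|, fun i => ?_,
    fun i ω => abs_nonneg _, fun i => ?_⟩
  · exact measurable_abs.comp (hident i).aemeasurable_fst.measurable_mk
  · filter_upwards [(hident i).aemeasurable_fst.ae_eq_mk,
      (hident i).symm.ae_snd (p := fun x => 0 ≤ x) measurableSet_Ici hX] with ω h1 h2
    rw [← h1, abs_of_nonneg h2]

end Main

theorem theorem2p3 {Ω : Type*} [MeasurableSpace Ω] (P : Measure Ω) [IsProbabilityMeasure P]
    (X : Ω → ℝ) (Xs : ℕ → Ω → ℝ)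
    (hnonneg : ∀ᵐ ω ∂P, 0 ≤ X ω)
    (hindep : iIndepFun Xs P)
    (hident : ∀ n, IdentDistrib (Xs n) X P P) :
    (∀ p : ℝ, 0 < p → p < 1 →
      Tendsto (fun n : ℕ => (n : ℝ≥0∞) * P {ω | (n : ℝ) ^ (1 / p) < X ω}) atTop (𝓝 0) →
      ∀ s : ℝ, 0 < s →
        limsup (fun n : ℕ => logRate P n {ω | s * (n : ℝ) ^ (1 / p) < partialSum Xs n ω}) atTop
            = -((upperTailExponent P X - (p : EReal)) / (p : EReal)) ∧
        liminf (fun n : ℕ => logRate P n {ω | s * (n : ℝ) ^ (1 / p) < partialSum Xs n ω}) atTop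
            = -((lowerTailExponent P X - (p : EReal)) / (p : EReal)) ∧
        ∀ α : EReal,
          Tendsto (fun n : ℕ => logRate P n {ω | s * (n : ℝ) ^ (1 / p) < partialSum Xs n ω})
              atTop (𝓝 (-((α - (p : EReal)) / (p : EReal)))) ↔
            upperTailExponent P X = α ∧ lowerTailExponent P X = α) ∧
    (∀ p μ : ℝ, 1 ≤ p → p < 2 →
      Integrable X P → ∫ ω, X ω ∂P = μ → 0 < μ →
      Tendsto (fun n : ℕ => (n : ℝ≥0∞) * P {ω | (n : ℝ) ^ (1 / p) < X ω}) atTop (𝓝 0) →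
      ∀ s : ℝ, 0 < s →
        limsup (fun n : ℕ =>
            logRate P n {ω | n * μ + s * (n : ℝ) ^ (1 / p) < partialSum Xs n ω}) atTop
            = -((upperTailExponent P X - (p : EReal)) / (p : EReal)) ∧
        liminf (fun n : ℕ =>
            logRate P n {ω | n * μ + s * (n : ℝ) ^ (1 / p) < partialSum Xs n ω}) atTop
            = -((lowerTailExponent P X - (p : EReal)) / (p : EReal)) ∧
        ∀ α : EReal,
          Tendsto (fun n : ℕ =>
              logRate P n {ω | n * μ + s * (n : ℝ) ^ (1 / p) < partialSum Xs n ω})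
              atTop (𝓝 (-((α - (p : EReal)) / (p : EReal)))) ↔
            upperTailExponent P X = α ∧ lowerTailExponent P X = α) := by
  obtain ⟨Y, hm, h0, hXY⟩ := exists_measurable_nonneg_version hnonneg hident
  have hYX : ∀ i, IdentDistrib (Y i) X P P := fun i =>
    (IdentDistrib.of_ae_eq (hm i).aemeasurable (hXY i).symm).trans (hident i)
  have hid : ∀ i, IdentDistrib (Y i) (Y 0) P P := fun i => (hYX i).trans (hYX 0).symm
  have hind : iIndepFun Y P := hindep.congr hXY
  have htail : ∀ v : ℝ, P {ω | v < X ω} = P {ω | v < Y 0 ω} := fun v =>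
    ((hYX 0).measure_mem_eq (measurableSet_Ioi (a := v))).symm
  have hlog : ∀ t : ℝ, P {ω | t < Real.log (X ω)} = P {ω | t < Real.log (Y 0 ω)} := fun t =>
    (((hYX 0).comp Real.measurable_log).measure_mem_eq (measurableSet_Ioi (a := t))).symm
  have hsum : ∀ (n : ℕ) (a : ℝ), logRate P n {ω | a < partialSum Xs n ω} =
      logRate P n {ω | a < partialSum Y n ω} := by
    intro n a
    have : P {ω | a < partialSum Xs n ω} = P {ω | a < partialSum Y n ω} := by
      refine measure_congr ?_
      filter_upwards [ae_all_iff.2 hXY] with ω hω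
      have : partialSum Xs n ω = partialSum Y n ω := Finset.sum_congr rfl fun i _ => hω i
      exact congrArg (a < ·) this
    rw [logRate, logRate, this]
  simp only [htail, hsum, upperTailExponent, lowerTailExponent, hlog]
  refine ⟨fun p hp0 hp1 ht s hs => ?_, fun p μ hp1 hp2 hint hμ hμ0 ht s hs => ?_⟩
  · obtain ⟨C, hC, hCt⟩ := exists_measureReal_lt_le_rpow hp0 ht
    -- With centering `0`, the Laplace bound is just `exp (-l * Y 0) ≤ 1`, so `D = 0`.
    have h := limsup_liminf_logRate hm h0 hind hid hp0 hp1
      (fun l y hl hy hly => integral_exp_mul_min_le_of_lt_one (hm 0) (h0 0) hC hCt hp1 hl hy hly)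
      ht (exists_forall_measureReal_sum_le hm h0 hind hid hp0 le_rfl (fun l hl _ => by
        refine (integral_mono_of_nonneg (ae_of_all _ fun _ => (Real.exp_pos _).le)
          (integrable_const (1 : ℝ)) (ae_of_all _ fun ω => ?_)).trans (by simp)
        exact Real.exp_le_one_iff.2 (by nlinarith [h0 0 ω])) (D := 0) le_rfl) hs
    simp only [mul_zero, zero_add] at h
    exact ⟨h.1, h.2, tendsto_neg_sub_div_iff hp0 h.1 h.2⟩
  · have hp0 : 0 < p := by linarith
    obtain ⟨C, hC, hCt⟩ := exists_measureReal_lt_le_rpow hp0 ht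
    have hYint : Integrable (Y 0) P := (hYX 0).integrable_iff.2 hint
    have hYμ : ∫ ω, Y 0 ω ∂P = μ := (hYX 0).integral_eq.trans hμ
    have hlap : ∃ D, 0 ≤ D ∧ ∀ l, 0 < l → l ≤ 1 → ∫ ω, Real.exp (-l * Y 0 ω) ∂P ≤
        Real.exp (-l * μ + D * l ^ p) := by
      rcases hp1.eq_or_lt with rfl | hp1
      -- At `p = 1`, taking `D = μ` makes the right side `exp 0`, so the trivial bound by `1`
      -- suffices.
      · refine ⟨μ, hμ0.le, fun l hl _ => ?_⟩
        refine (integral_mono_of_nonneg (ae_of_all _ fun _ => (Real.exp_pos _).le)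
          (integrable_const (1 : ℝ)) (ae_of_all _ fun ω => ?_)).trans ?_
        · exact Real.exp_le_one_iff.2 (by nlinarith [h0 0 ω])
        · simp [mul_comm]
      · refine ⟨C * 2 / (2 - p) + C / (p - 1), ?_, fun l hl _ => ?_⟩
        · have := sub_pos.2 hp1
          have := sub_pos.2 hp2
          positivity
        · have := integral_exp_neg_mul_le (hm 0) (h0 0) hC hCt hp1 hp2 hYint hl
          rwa [hYμ] at this
    obtain ⟨D, hD, hlap⟩ := hlap
    have h := limsup_liminf_logRate hm h0 hind hid hp0 hp2
      (fun l y hl hy hly => hYμ ▸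
        integral_exp_mul_min_le_of_lt_two (hm 0) (h0 0) hC hCt hp2 hYint hl hy hly)
      ht (exists_forall_measureReal_sum_le hm h0 hind hid hp0 hμ0.le hlap hD) hs
    exact ⟨h.1, h.2, tendsto_neg_sub_div_iff hp0 h.1 h.2⟩
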